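/- Let $r=p/q$ be a rational number in lowest terms with $q\ge 1$, let $m\ge 0$ be an integer, and let $(u_n)_{n\ge1}$ be a sequence of positive integers. Given $y_0$, define $$x_1=q,\qquad y_j=y_{j-1}(1+u_jx_j),\qquad x_{j+1}=x_jy_j\qquad (j\ge1).$$ For a finite continued fraction $[a_0;a_1,\dots,a_N]$ with $a_0\in\mathbb Z$ and $a_j\in\mathbb Z_{>0}$ for $1\le j\le N$, let $q_n$ be the denominator of its $n$-th convergent, so that $q_{-1}=0$, $q_0=1$, $q_{n+1}=a_{n+1}q_n+q_{n-1}$. Let the real number $\alpha$ be given in one of the following three ways: 1. (Engel) $\alpha=\frac pq+\sum_{j\ge2}\frac1{x_j}$, where $\frac pq=[a_0;a_1,\dots,a_{2k}]$ for some $k\ge 0$ and $y_0=mq+q_{2k-1}+1$; 2. (Pierce) $q>1$ and $\alpha=\frac pq+\sum_{j\ge2}\frac{(-1)^j}{x_j}$, where $\frac pq=[a_0;a_1,\dots,a_{2k}]$ and $y_0=mq+q_{2k-1}-1$, with $m\ge1$ if $q_{2k-1}=1$; 3. (Pierce) $q>1$ and $\alpha=\frac pq-\sum_{j\ge2}\frac{(-1)^j}{x_j}$,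 where $\frac pq=[a_0;a_1,\dots,a_{2k+1}]$ for some $k\ge 0$ and $y_0=mq+q_{2k}-1$, with $m\ge1$ if $q_{2k}=1$. For some integer $d\ge1$, let $$\lambda=\frac{d+2+\sqrt{d(d+4)}}2,$$ and suppose that for all $n\ge1$ $$u_n=\sum_{j=0}^{d-1}v_n^{(j)}x_n^{\,d-1-j},$$ where the $(v_n^{(j)})_{n\ge1}$ are integer sequences with $v_n^{(0)}>0$ for all $n\ge 1$ and, as $n\to\infty$, for some real $\nu$ with $0\le\nu<\lambda$, $$\log v_n^{(0)}=O(\nu^n),\qquad v_n^{(j)}=O(v_n^{(0)})\quad(1\le j\le d-1).$$ Then the series defining $\alpha$ converges, and $\alpha$ has irrationality exponent exactly $\mu(\alpha)=\lambda$, where $\mu(\alpha)$ is the supremum of the real numbers $\mu$ for which $0<|\alpha-P/Q|<1/Q^{\mu}$ holds for infinitely many rational numbers $P/Q$ (in lowest terms with $Q>0$). -/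

import Mathlib

open Filter Asymptotics

noncomputable section

namespace EngelPierce

/-- The nested finite continued fraction `a i + 1 / (a (i+1) + 1 / (⋯ + 1 / a (i+n)))`. -/
def cfFrom (a : ℕ → ℤ) : ℕ → ℕ → ℚ
  | i, 0 => a i
  | i, n + 1 => a i + 1 / cfFrom a (i + 1) n

/-- Denominators of convergents with the index shifted by one: `cfDen a (n + 1) = q_n` is the
denominator of the `n`-th convergent `[a 0; a 1, …, a n]`, and `cfDen a 0 = q_{-1} = 0`. -/
def cfDen (a : ℕ → ℤ) : ℕ → ℤ
  | 0 => 0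
  | 1 => 1
  | n + 2 => a (n + 1) * cfDen a (n + 1) + cfDen a n

/-- `r = [a 0; a 1, …, a N]` with integers `a 0`, and `a j > 0` for `1 ≤ j ≤ N`. -/
def IsCFExpansion (r : ℚ) (a : ℕ → ℤ) (N : ℕ) : Prop :=
  (∀ j, 1 ≤ j → j ≤ N → 0 < a j) ∧ r = cfFrom a 0 N

/-- The pair `(x_{n+1}, y_n)`, where `x_1 = q`, `y_0 = y₀`, and for `j ≥ 1`
`y_j = y_{j-1} (1 + u_j x_j)`, `x_{j+1} = x_j y_j`. -/
def pairSeq (q y₀ : ℤ) (u : ℕ → ℤ) : ℕ → ℤ × ℤ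
  | 0 => (q, y₀)
  | n + 1 =>
    let x := (pairSeq q y₀ u n).1
    let y := (pairSeq q y₀ u n).2 * (1 + u (n + 1) * x)
    (x * y, y)

/-- The sequence `(x_n)`, meaningful for `n ≥ 1`. -/
def xSeq (q y₀ : ℤ) (u : ℕ → ℤ) (n : ℕ) : ℤ := (pairSeq q y₀ u (n - 1)).1

/-- The sequence `(y_n)`, `n ≥ 0`. -/
def ySeq (q y₀ : ℤ) (u : ℕ → ℤ) (n : ℕ) : ℤ := (pairSeq q y₀ u n).2

theorem xSeq_one (q y₀ : ℤ) (u : ℕ → ℤ) : xSeq q y₀ u 1 = q := rfl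

theorem ySeq_zero (q y₀ : ℤ) (u : ℕ → ℤ) : ySeq q y₀ u 0 = y₀ := rfl

theorem ySeq_rec (q y₀ : ℤ) (u : ℕ → ℤ) (j : ℕ) (hj : 1 ≤ j) :
    ySeq q y₀ u j = ySeq q y₀ u (j - 1) * (1 + u j * xSeq q y₀ u j) := by
  obtain ⟨n, rfl⟩ := Nat.exists_eq_add_of_le' hj
  rfl

theorem xSeq_rec (q y₀ : ℤ) (u : ℕ → ℤ) (j : ℕ) (hj : 1 ≤ j) :
    xSeq q y₀ u (j + 1) = xSeq q y₀ u j * ySeq q y₀ u j := by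
  obtain ⟨n, rfl⟩ := Nat.exists_eq_add_of_le' hj
  rfl

/-- The three families: a rational number plus an Engel series, plus a Pierce series,
or minus a Pierce series. -/
inductive SeriesKind
  | engel
  | piercePlus
  | pierceMinus

/-- The numerator (`1`, `(-1)^j` or `-(-1)^j`) of the `j`-th term of the series, `j ≥ 2`. -/
def SeriesKind.sign : SeriesKind → ℕ → ℝ
  | .engel, _ => 1
  | .piercePlus, j => (-1) ^ j
  | .pierceMinus, j => -(-1) ^ j

/-- `y₀` is the initial value prescribed for the rational number `r = p/q` and the parameter `m`,
together with the restrictions on `q` and `m` in the two Pierce cases. -/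
def SeriesKind.IsInitial (r : ℚ) (m : ℕ) (y₀ : ℤ) : SeriesKind → Prop
  | .engel => ∃ (k : ℕ) (a : ℕ → ℤ), IsCFExpansion r a (2 * k) ∧
      y₀ = m * r.den + cfDen a (2 * k) + 1
  | .piercePlus => 1 < r.den ∧ ∃ (k : ℕ) (a : ℕ → ℤ), IsCFExpansion r a (2 * k) ∧
      y₀ = m * r.den + cfDen a (2 * k) - 1 ∧ (cfDen a (2 * k) = 1 → 1 ≤ m)
  | .pierceMinus => 1 < r.den ∧ ∃ (k : ℕ) (a : ℕ → ℤ), IsCFExpansion r a (2 * k + 1) ∧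
      y₀ = m * r.den + cfDen a (2 * k + 1) - 1 ∧ (cfDen a (2 * k + 1) = 1 → 1 ≤ m)

/-- The `j`-th term of the series added to `r`. -/
def seriesTerm (T : SeriesKind) (r : ℚ) (y₀ : ℤ) (u : ℕ → ℤ) (j : ℕ) : ℝ :=
  T.sign j / (xSeq r.den y₀ u j : ℝ)

/-- The irrationality exponent: the supremum (possibly infinite) of the real numbers `μ` such that
`0 < |α - P/Q| < 1 / Q ^ μ` for infinitely many rational numbers `P/Q`. -/
def irrationalityExponent (α : ℝ) : EReal :=
  sSup (Real.toEReal '' {μ : ℝ |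
    {s : ℚ | 0 < |α - (s : ℝ)| ∧ |α - (s : ℝ)| < 1 / (s.den : ℝ) ^ μ}.Infinite})

/-- The number `λ = (d + 2 + √(d (d + 4))) / 2`. -/
def lam (d : ℕ) : ℝ := ((d : ℝ) + 2 + Real.sqrt ((d : ℝ) * ((d : ℝ) + 4))) / 2

end EngelPierce

end

open Filter Asymptotics Topology

/-! In every case, the partial sums `P n / x n` alternate with fractions `Q n / z n`, where `z n = y
(n + 1) - δ` and `δ` is the ratio of consecutive signs. Neighbours have determinant ±1
(`exists_intermediate`, `sub_partialNum_mul`). The prescribed `y₀` is exactly what starts this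
pattern: `p * (y₀ - δ)` must be minus the first sign modulo `q`, a congruence that the penultimate
convergent of `p/q` solves. Taking logarithms turns the recursion for `(x, y)` into a perturbed
linear one with dominant eigenvalue `λ`, so `log x n` is asymptotic to `L * λ ^ n` with `L > 0`, and
`log z n` to `(λ - 1) * L * λ ^ n`. Lower bound: the tail after `P n / x n` is at most `2 / x (n +
1)`, roughly `x n ^ (-λ)`. Upper bound: along the chain, the logarithm of the denominator grows by
factors tending to `λ - 1` and `λ / (λ - 1)`. The first is the larger because `(λ - 1) ^ 2 = d * λ ≥
λ`, and `finite_approx_of_chain` then bounds the exponent by `1 + (λ - 1)`. -/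

namespace EngelPierce

/-! ### Continued fractions: determinants and lowest terms. -/

/-- Numerators of convergents with the index shifted by one: `cfNum a (n + 1) = p_n`. -/
def cfNum (a : ℕ → ℤ) : ℕ → ℤ
  | 0 => 1
  | 1 => a 0
  | n + 2 => a (n + 1) * cfNum a (n + 1) + cfNum a n

theorem cfNum_mul_cfDen_sub (a : ℕ → ℤ) (n : ℕ) :
    cfNum a (n + 1) * cfDen a n - cfNum a n * cfDen a (n + 1) = (-1) ^ (n + 1) := by
  induction n with
  | zero => simp [cfNum, cfDen]
  | succ n ih =>
    rw [cfNum, cfDen, pow_succ, ← ih]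
    ring

theorem cfDen_nonneg_and_pos {a : ℕ → ℤ} {N : ℕ} (ha : ∀ j, 1 ≤ j → j ≤ N → 0 < a j) :
    ∀ n, n ≤ N → 0 ≤ cfDen a n ∧ 0 < cfDen a (n + 1)
  | 0, _ => by simp [cfDen]
  | n + 1, hn => by
    obtain ⟨h1, h2⟩ := cfDen_nonneg_and_pos ha n (by omega)
    refine ⟨h2.le, ?_⟩
    rw [cfDen]
    have := mul_pos (ha (n + 1) (by omega) hn) h2
    omega

theorem cfFrom_pos {a : ℕ → ℤ} (n : ℕ) :
    ∀ i, (∀ j, i ≤ j → j ≤ i + n → 0 < a j) → 0 < cfFrom a i n := by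
  induction n with
  | zero =>
    intro i h
    simpa [cfFrom] using h i le_rfl le_rfl
  | succ n ih =>
    intro i h
    have h1 : (0 : ℚ) < a i := by exact_mod_cast h i le_rfl (by omega)
    have h2 := ih (i + 1) fun j hj hj' => h j (by omega) (by omega)
    rw [cfFrom]
    positivity

/-- The classical formula with complete quotients, cleared of denominators; each step of the
induction on `i` unfolds one more level of the tail. -/
theorem cfFrom_mul_tail {a : ℕ → ℤ} {N : ℕ} (ha : ∀ j, 1 ≤ j → j ≤ N → 0 < a j) :
    ∀ i l, i + 1 + l = N →
      cfFrom a 0 N * (cfDen a (i + 1) * cfFrom a (i + 1) l + cfDen a i) =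
        cfNum a (i + 1) * cfFrom a (i + 1) l + cfNum a i
  | 0, l, h => by
    obtain rfl : N = l + 1 := by omega
    have := cfFrom_pos l 1 fun j hj hj' => ha j hj (by omega)
    simp only [cfFrom, cfDen, cfNum, zero_add]
    field_simp
    push_cast
    ring
  | i + 1, l, h => by
    have ih := cfFrom_mul_tail ha i (l + 1) (by omega)
    have := cfFrom_pos l (i + 2) fun j hj hj' => ha j (by omega) (by omega)
    rw [cfFrom] at ih
    simp only [cfDen, cfNum, Int.cast_add, Int.cast_mul]
    field_simp at ih
    linear_combination ih

theorem cfFrom_mul_cfDen {a : ℕ → ℤ} {N : ℕ} (ha : ∀ j, 1 ≤ j → j ≤ N → 0 < a j) :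
    cfFrom a 0 N * cfDen a (N + 1) = cfNum a (N + 1) := by
  rcases N with _ | N
  · simp [cfFrom, cfDen, cfNum]
  · have := cfFrom_mul_tail ha N 0 (by omega)
    rw [show cfFrom a (N + 1) 0 = a (N + 1) from rfl] at this
    simp only [cfDen, cfNum, Int.cast_add, Int.cast_mul]
    linear_combination this

/-- The determinant ±1 is a Bézout relation, so the last convergent is already in lowest terms. -/
theorem IsCFExpansion.num_den {r : ℚ} {a : ℕ → ℤ} {N : ℕ} (h : IsCFExpansion r a N) :
    r.num = cfNum a (N + 1) ∧ (r.den : ℤ) = cfDen a (N + 1) := by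
  have hpos := (cfDen_nonneg_and_pos h.1 N le_rfl).2
  have hmul := cfFrom_mul_cfDen h.1
  rw [← h.2] at hmul
  have hdet := cfNum_mul_cfDen_sub a N
  have hcop : IsCoprime (cfNum a (N + 1)) (cfDen a (N + 1)) := by
    refine ⟨(-1) ^ (N + 1) * cfDen a N, -(-1) ^ (N + 1) * cfNum a N, ?_⟩
    have : ((-1 : ℤ) ^ (N + 1)) * (-1) ^ (N + 1) = 1 := by
      rw [← mul_pow]; simp
    linear_combination (-1) ^ (N + 1) * hdet + this
  have hr : r = (cfNum a (N + 1) : ℚ) / (cfDen a (N + 1) : ℚ) := by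
    have : (cfDen a (N + 1) : ℚ) ≠ 0 := by exact_mod_cast hpos.ne'
    field_simp
    exact hmul
  rw [hr]
  have hc := Int.isCoprime_iff_nat_coprime.1 hcop
  exact ⟨Rat.num_div_eq_of_coprime hpos hc, Rat.den_div_eq_of_coprime hpos hc⟩

theorem IsCFExpansion.num_mul_cfDen {r : ℚ} {a : ℕ → ℤ} {N : ℕ} (h : IsCFExpansion r a N) :
    r.num * cfDen a N = (-1) ^ (N + 1) + r.den * cfNum a N := by
  rw [h.num_den.1, h.num_den.2]
  linear_combination cfNum_mul_cfDen_sub a N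

theorem IsCFExpansion.cfDen_pos {r : ℚ} {a : ℕ → ℤ} {N : ℕ} (h : IsCFExpansion r a N)
    (hr : 1 < r.den) : 0 < cfDen a N := by
  rcases N with _ | N
  · have := h.num_den.2
    simp only [cfDen] at this
    omega
  · exact (cfDen_nonneg_and_pos h.1 N (by omega)).2

/-! ### Bounds for the irrationality exponent from a sequence of approximations. -/

theorem finite_rat_den_le (α : ℝ) (B : ℕ) : {s : ℚ | s.den ≤ B ∧ |α - s| ≤ 1}.Finite := by
  have hf : ((Set.Icc (-⌈B * (|α| + 1)⌉) ⌈B * (|α| + 1)⌉ ×ˢ Set.Iic B : Set (ℤ × ℕ))).Finite :=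
    (Set.finite_Icc _ _).prod (Set.finite_Iic B)
  refine (hf.image fun t : ℤ × ℕ => (t.1 / t.2 : ℚ)).subset ?_
  rintro s ⟨h1, h2⟩
  refine ⟨(s.num, s.den), ⟨?_, h1⟩, Rat.num_div_den s⟩
  have hs : |(s : ℝ)| ≤ |α| + 1 := by
    have := abs_sub_abs_le_abs_sub (s : ℝ) α
    rw [abs_sub_comm] at this
    linarith
  have hd : (0 : ℝ) < s.den := by exact_mod_cast s.den_pos
  have hn : |(s.num : ℝ)| ≤ B * (|α| + 1) := by
    have : (s.num : ℝ) = s.den * s := by exact_mod_cast (Rat.den_mul_eq_num s).symm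
    rw [this, abs_mul, abs_of_pos hd]
    have : (s.den : ℝ) ≤ B := by exact_mod_cast h1
    gcongr
  have hn' : |s.num| ≤ ⌈B * (|α| + 1)⌉ := by
    have := hn.trans (Int.le_ceil _)
    exact_mod_cast this
  exact Set.mem_Icc.2 (abs_le.1 hn')

theorem one_div_mul_le_abs_sub {s : ℚ} {p q : ℤ} (hq : 0 < q) (h : (s : ℝ) ≠ p / q) :
    1 / ((s.den : ℝ) * q) ≤ |(s : ℝ) - p / q| := by
  have hd : (0 : ℝ) < s.den := by exact_mod_cast s.den_pos
  have hq' : (0 : ℝ) < q := by exact_mod_cast hq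
  have hs : (s : ℝ) = s.num / s.den := by exact_mod_cast (Rat.num_div_den s).symm
  have e : (s : ℝ) - p / q = ((s.num * q - s.den * p : ℤ) : ℝ) / (s.den * q) := by
    rw [hs]; push_cast; field_simp
  have h0 : (s.num * q - s.den * p : ℤ) ≠ 0 := by
    intro h0
    rw [h0, Int.cast_zero, zero_div, sub_eq_zero] at e
    exact h e
  rw [e, abs_div, abs_of_pos (mul_pos hd hq')]
  gcongr
  exact_mod_cast Int.one_le_abs h0

/-- If `q ≤ 2 C B < q'` for consecutive terms of a chain of good approximations to `α`, then a
fraction with denominator `B` is at distance at least `1 / (2 B q')` from `α`. -/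
theorem one_div_le_abs_sub_of_chain {α C q'' : ℝ} {s : ℚ} {p q p' q' : ℤ}
    (hq : 0 < q) (hqq' : q ≤ q') (hne : p * q' ≠ p' * q)
    (h1 : |α - p / q| ≤ C / (q * q')) (h2 : |α - p' / q'| ≤ C / (q' * q''))
    (hB' : 2 * C * s.den < q') (hB'' : 2 * C * s.den < q'') (hq'' : 0 < q'') :
    1 / (2 * (s.den : ℝ) * q') ≤ |α - s| := by
  have hd : (0 : ℝ) < s.den := by exact_mod_cast s.den_pos
  have hq0 : (0 : ℝ) < q := by exact_mod_cast hq
  have hq0' : (0 : ℝ) < q' := by exact_mod_cast hq.trans_le hqq'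
  have hqq : (q : ℝ) ≤ q' := by exact_mod_cast hqq'
  by_cases h : (s : ℝ) = p / q
  -- The determinant is nonzero, so `s` differs from one of the two fractions. The distance to that
  -- one, at least `1 / (B q)` or `1 / (B q')`, is at least twice the fraction's own error.
  · have hs : (s : ℝ) ≠ p' / q' := by
      rw [h]
      intro h'
      rw [div_eq_div_iff hq0.ne' hq0'.ne'] at h'
      exact hne (by exact_mod_cast h')
    have h3 := one_div_mul_le_abs_sub (hq.trans_le hqq') hs
    have h4 : C / (q' * q'') ≤ 1 / (2 * (s.den : ℝ) * q') := by
      rw [div_le_div_iff₀ (by positivity) (by positivity)]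
      nlinarith
    have h5 : 1 / ((s.den : ℝ) * q') = 2 * (1 / (2 * (s.den : ℝ) * q')) := by field_simp
    have h6 := abs_sub_le (s : ℝ) α (p' / q')
    rw [abs_sub_comm (s : ℝ) α] at h6
    linarith
  · have h3 := one_div_mul_le_abs_sub hq h
    have h4 : C / (q * q') ≤ 1 / (2 * (s.den : ℝ) * q) := by
      rw [div_le_div_iff₀ (by positivity) (by positivity)]
      nlinarith
    have h5 : 1 / ((s.den : ℝ) * q) = 2 * (1 / (2 * (s.den : ℝ) * q)) := by field_simp
    have h6 := abs_sub_le (s : ℝ) α (p / q)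
    rw [abs_sub_comm (s : ℝ) α] at h6
    have h7 : 1 / (2 * (s.den : ℝ) * q') ≤ 1 / (2 * (s.den : ℝ) * q) := by gcongr
    linarith

/-- A chain of approximations `…, P n / x n, Q n / z n, P (n + 1) / x (n + 1), …` in which the
logarithms of the denominators grow by a factor of at most `τ` bounds the quality of all rational
approximations. -/
theorem finite_approx_of_chain {α C τ μ : ℝ} {P x Q z : ℕ → ℤ} (hC : 1 ≤ C)
    (hx : ∀ n, 0 < x n) (hxz : ∀ n, x n ≤ z n) (hzx : ∀ n, z n ≤ x (n + 1))
    (hxt : Tendsto (fun n => (x n : ℝ)) atTop atTop)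
    (h1 : ∀ n, |α - P n / x n| ≤ C / (x n * z n))
    (h2 : ∀ n, |α - Q n / z n| ≤ C / (z n * x (n + 1)))
    (hne1 : ∀ n, P n * z n ≠ Q n * x n) (hne2 : ∀ n, Q n * x (n + 1) ≠ P (n + 1) * z n)
    (hτ : 0 < τ) (hlog1 : ∀ᶠ n in atTop, Real.log (z n) ≤ τ * Real.log (x n))
    (hlog2 : ∀ᶠ n in atTop, Real.log (x (n + 1)) ≤ τ * Real.log (z n)) (hμ : τ + 1 < μ) :
    {s : ℚ | 0 < |α - (s : ℝ)| ∧ |α - (s : ℝ)| < 1 / (s.den : ℝ) ^ μ}.Finite := by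
  obtain ⟨n₀, hn₀⟩ := eventually_atTop.1 (hlog1.and hlog2)
  have hpow : Tendsto (fun b : ℝ => b ^ (μ - (τ + 1))) atTop atTop :=
    tendsto_rpow_atTop (by linarith)
  -- For denominators `B ≥ b₀`, the lower bound `1 / (2 B (2 C B) ^ τ)` is at least `1 / B ^ μ`;
  -- smaller denominators leave finitely many fractions.
  obtain ⟨b₀, hb₀⟩ := eventually_atTop.1 (hpow.eventually_ge_atTop (2 * (2 * C) ^ τ))
  have hxmono : Monotone x := monotone_nat_of_le_succ fun n => (hxz n).trans (hzx n)
  have hz : ∀ n, 0 < z n := fun n => (hx n).trans_le (hxz n)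
  refine (finite_rat_den_le α (⌈b₀⌉₊ + (x n₀).toNat)).subset ?_
  rintro s ⟨-, hs⟩
  have hd1 : (1 : ℝ) ≤ s.den := by exact_mod_cast s.den_pos
  have hd : (0 : ℝ) < s.den := by linarith
  refine ⟨?_, ?_⟩
  swap
  · refine hs.le.trans ?_
    rw [div_le_one (by positivity)]
    exact Real.one_le_rpow hd1 (by linarith)
  by_contra! hB
  have hB1 : b₀ ≤ s.den := by
    refine (Nat.le_ceil b₀).trans ?_
    exact_mod_cast (by omega : ⌈b₀⌉₊ ≤ s.den)
  have hB2 : (x n₀ : ℝ) ≤ 2 * C * s.den := by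
    have : (x n₀ : ℝ) ≤ s.den := by exact_mod_cast (by omega : x n₀ ≤ s.den)
    nlinarith
  have key : ∀ q q' : ℤ, 0 < q → 0 < q' → (q : ℝ) ≤ 2 * C * s.den →
      Real.log q' ≤ τ * Real.log q → 1 / (2 * (s.den : ℝ) * q') ≤ |α - s| → False := by
    intro q q' hq hq' hqB hl hle
    have hq0 : (0 : ℝ) < q := by exact_mod_cast hq
    have hq0' : (0 : ℝ) < q' := by exact_mod_cast hq'
    have hq'le : (q' : ℝ) ≤ (2 * C) ^ τ * (s.den : ℝ) ^ τ := by
      calc (q' : ℝ) = Real.exp (Real.log q') := (Real.exp_log hq0').symm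
        _ ≤ Real.exp (Real.log q * τ) := by
          apply Real.exp_le_exp.2; linarith
        _ = (q : ℝ) ^ τ := by rw [Real.rpow_def_of_pos hq0]
        _ ≤ (2 * C * s.den) ^ τ := Real.rpow_le_rpow hq0.le hqB hτ.le
        _ = _ := Real.mul_rpow (by linarith) hd.le
    have h3 := hle.trans_lt hs
    rw [div_lt_div_iff₀ (by positivity) (by positivity)] at h3
    have h4 : (s.den : ℝ) ^ μ = (s.den : ℝ) ^ (μ - (τ + 1)) * (s.den * (s.den : ℝ) ^ τ) := by
      conv_rhs => rw [← Real.rpow_one_add' hd.le (by linarith), ← Real.rpow_add hd]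
      congr 1; ring
    have h5 := hb₀ _ hB1
    have h6 : (0 : ℝ) < s.den * (s.den : ℝ) ^ τ := by positivity
    have h7 : 2 * (s.den : ℝ) * q' ≤ 2 * s.den * ((2 * C) ^ τ * (s.den : ℝ) ^ τ) := by gcongr
    have h8 := mul_le_mul_of_nonneg_right h5 h6.le
    rw [← h4] at h8
    linarith
  -- Minimality of this index places `2 C B` between `x n` and `x (n + 1)`; comparison with `z n`
  -- then picks the pair of neighbours to use.
  have hex : ∃ n, 2 * C * s.den < x n := (hxt.eventually_gt_atTop _).exists
  classical
  obtain ⟨n, hn⟩ : ∃ n, Nat.find hex = n + 1 := by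
    apply Nat.exists_eq_succ_of_ne_zero
    intro h0
    have h' := Nat.find_spec hex
    rw [h0] at h'
    have : (x 0 : ℝ) ≤ x n₀ := by exact_mod_cast hxmono n₀.zero_le
    linarith
  have hgt : 2 * C * s.den < x (n + 1) := hn ▸ Nat.find_spec hex
  have hle : (x n : ℝ) ≤ 2 * C * s.den := not_lt.1 (Nat.find_min hex (by omega))
  have hnn : n₀ ≤ n := by
    by_contra! hlt
    have : (x (n + 1) : ℝ) ≤ x n₀ := by exact_mod_cast hxmono (by omega : n + 1 ≤ n₀)
    linarith
  obtain ⟨hl1, hl2⟩ := hn₀ n hnn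
  have hgt' : 2 * C * s.den < z (n + 1) := hgt.trans_le (by exact_mod_cast hxz (n + 1))
  by_cases hzn : 2 * C * s.den < z n
  · exact key (x n) (z n) (hx n) (hz n) hle hl1
      (one_div_le_abs_sub_of_chain (hx n) (hxz n) (hne1 n) (h1 n) (h2 n) hzn hgt
        (by exact_mod_cast hx (n + 1)))
  · exact key (z n) (x (n + 1)) (hz n) (hx _) (not_lt.1 hzn) hl2
      (one_div_le_abs_sub_of_chain (hz n) (hzx n) (hne2 n) (h2 n) (h1 (n + 1)) hgt hgt'
        (by exact_mod_cast hz (n + 1)))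

theorem irrationalityExponent_le_of_finite {α l : ℝ}
    (h : ∀ μ, l < μ →
      {s : ℚ | 0 < |α - (s : ℝ)| ∧ |α - (s : ℝ)| < 1 / (s.den : ℝ) ^ μ}.Finite) :
    irrationalityExponent α ≤ l := by
  apply sSup_le
  rintro _ ⟨μ, hμ, rfl⟩
  rw [EReal.coe_le_coe_iff]
  by_contra! hlt
  exact hμ (h μ hlt)

/-- A finite set is closed, so it would contain the limit `α` of the approximations, which `0 < |α -
s|` forbids. Reducing `P n / x n` to lowest terms only weakens the required inequality, as `μ ≥ 0`.
-/
theorem infinite_approx_of_tendsto {α μ : ℝ} (hμ : 0 ≤ μ) {P x : ℕ → ℤ} (hx : ∀ n, 0 < x n)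
    (hlim : Tendsto (fun n => (P n / x n : ℝ)) atTop (𝓝 α)) (hne : ∀ n, α ≠ P n / x n)
    (h : ∀ᶠ n in atTop, |α - P n / x n| < 1 / (x n : ℝ) ^ μ) :
    {s : ℚ | 0 < |α - (s : ℝ)| ∧ |α - (s : ℝ)| < 1 / (s.den : ℝ) ^ μ}.Infinite := by
  intro hfin
  have hcl : IsClosed (((↑) : ℚ → ℝ) ''
      {s : ℚ | 0 < |α - (s : ℝ)| ∧ |α - (s : ℝ)| < 1 / (s.den : ℝ) ^ μ}) :=
    (hfin.image _).isClosed
  have hmem : α ∈ (((↑) : ℚ → ℝ) ''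
      {s : ℚ | 0 < |α - (s : ℝ)| ∧ |α - (s : ℝ)| < 1 / (s.den : ℝ) ^ μ}) := by
    refine hcl.mem_of_tendsto hlim (h.mono fun n hn => ⟨(P n / x n : ℚ), ⟨?_, ?_⟩, by push_cast; rfl⟩)
    · rw [abs_pos, sub_ne_zero]
      push_cast
      exact hne n
    · push_cast
      refine hn.trans_le ?_
      have h1 : (((P n : ℚ) / x n).den : ℤ) ≤ x n := by
        rw [← Rat.divInt_eq_div]
        exact Int.le_of_dvd (hx n) (Rat.den_dvd _ _)
      have h2 : (((P n : ℚ) / x n).den : ℝ) ≤ x n := by exact_mod_cast h1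
      have h3 : (0 : ℝ) < ((P n : ℚ) / x n).den := by exact_mod_cast Rat.den_pos _
      gcongr
  obtain ⟨s, ⟨hs, -⟩, rfl⟩ := hmem
  simp at hs

theorem le_irrationalityExponent_of_infinite {α l : ℝ} (hl : 0 < l)
    (h : ∀ μ, 0 ≤ μ → μ < l →
      {s : ℚ | 0 < |α - (s : ℝ)| ∧ |α - (s : ℝ)| < 1 / (s.den : ℝ) ^ μ}.Infinite) :
    (l : EReal) ≤ irrationalityExponent α := by
  apply le_of_forall_lt
  intro c hc
  -- The maximum with `0` makes the intermediate exponent nonnegative and also covers `c = ⊥`.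
  have hc' : max c 0 < (l : EReal) := max_lt hc (by exact_mod_cast hl)
  obtain ⟨μ, hμ1, hμ2⟩ := EReal.lt_iff_exists_real_btwn.1 hc'
  have h0 : (0 : EReal) < μ := (le_max_right _ _).trans_lt hμ1
  refine ((le_max_left _ _).trans_lt hμ1).trans_le (le_sSup ⟨μ, h μ ?_ ?_, rfl⟩)
  · exact_mod_cast h0.le
  · exact_mod_cast hμ2

/-! ### Asymptotics of perturbed linear recurrences. -/

theorem lam_sq (d : ℕ) : lam d ^ 2 = (d + 2) * lam d - 1 := by
  have h : Real.sqrt ((d : ℝ) * (d + 4)) ^ 2 = d * (d + 4) := Real.sq_sqrt (by positivity)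
  unfold lam
  linear_combination h / 4

theorem two_lt_lam {d : ℕ} (hd : 1 ≤ d) : 2 < lam d := by
  have hd' : (1 : ℝ) ≤ d := by exact_mod_cast hd
  have h : (1 : ℝ) < Real.sqrt ((d : ℝ) * (d + 4)) := by
    apply Real.lt_sqrt_of_sq_lt
    nlinarith
  unfold lam
  linarith

theorem tendsto_zero_of_le_mul_add {θ : ℝ} (h0 : 0 ≤ θ) (h1 : θ < 1) {s b : ℕ → ℝ}
    (hb : Tendsto b atTop (𝓝 0)) (h : ∀ n, |s (n + 1)| ≤ θ * |s n| + b n) :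
    Tendsto s atTop (𝓝 0) := by
  rw [Metric.tendsto_atTop]
  intro ε hε
  -- Once `b` is below this value, the iteration is dominated by `t ↦ θ * t + ε / 2 * (1 - θ)`,
  -- whose fixed point is `ε / 2`.
  have hε' : 0 < ε / 2 * (1 - θ) := mul_pos (by linarith) (by linarith)
  obtain ⟨N, hN⟩ := eventually_atTop.1 (hb.eventually_le_const hε')
  have hk : ∀ k, |s (N + k)| ≤ ε / 2 + θ ^ k * |s N| := by
    intro k
    induction k with
    | zero => simp; linarith
    | succ k ih =>
      have h2 := h (N + k)
      have h3 := hN (N + k) (by omega)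
      have h4 := mul_le_mul_of_nonneg_left ih h0
      rw [← add_assoc, pow_succ]
      nlinarith
  have hpow : Tendsto (fun k => θ ^ k * |s N|) atTop (𝓝 0) := by
    simpa using (tendsto_pow_atTop_nhds_zero_of_lt_one h0 h1).mul_const |s N|
  obtain ⟨M, hM⟩ := eventually_atTop.1 (hpow.eventually_lt_const (by linarith : (0 : ℝ) < ε / 2))
  refine ⟨N + M, fun n hn => ?_⟩
  have h2 := hk (n - N)
  have h3 := hM (n - N) (by omega)
  rw [Nat.add_sub_of_le (by omega)] at h2
  rw [Real.dist_eq, sub_zero]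
  linarith

theorem tendsto_of_eq_mul_add {θ b₀ : ℝ} (h0 : 0 ≤ θ) (h1 : θ < 1) {s b : ℕ → ℝ}
    (hb : Tendsto b atTop (𝓝 b₀)) (h : ∀ n, s (n + 1) = θ * s n + b n) :
    Tendsto s atTop (𝓝 (b₀ / (1 - θ))) := by
  have hθ : 1 - θ ≠ 0 := by linarith
  rw [← tendsto_sub_nhds_zero_iff]
  refine tendsto_zero_of_le_mul_add h0 h1 (b := fun n => |b n - b₀|) ?_ fun n => ?_
  · simpa using (tendsto_sub_nhds_zero_iff.2 hb).abs
  · have : s (n + 1) - b₀ / (1 - θ) = θ * (s n - b₀ / (1 - θ)) + (b n - b₀) := by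
      rw [h]; field_simp; ring
    rw [this]
    refine (abs_add_le _ _).trans ?_
    rw [abs_mul, abs_of_nonneg h0]

/-- Solutions of `W (n + 1) = l W n + e n` tending to infinity, with `e` of smaller exponential
order and bounded below, are asymptotic to a positive multiple of `l ^ n`. -/
theorem exists_tendsto_div_pow {l κ K : ℝ} (hl : 1 < l) (hκ0 : 0 ≤ κ) (hκ : κ < l) {W e : ℕ → ℝ}
    (hW : ∀ n, W (n + 1) = l * W n + e n) (hWt : Tendsto W atTop atTop)
    (he : e =O[atTop] fun n => κ ^ n) (heK : ∀ᶠ n in atTop, -K ≤ e n) :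
    ∃ L, 0 < L ∧ Tendsto (fun n => W n / l ^ n) atTop (𝓝 L) := by
  have hl0 : 0 < l := by linarith
  have hdiff : ∀ n, W (n + 1) / l ^ (n + 1) - W n / l ^ n = e n / l ^ (n + 1) := by
    intro n
    rw [hW, pow_succ]
    field_simp
    ring
  have hsum : Summable fun n => e n / l ^ (n + 1) := by
    refine summable_of_isBigO_nat
      (summable_geometric_of_lt_one (div_nonneg hκ0 hl0.le) ((div_lt_one hl0).2 hκ)) ?_
    have h1 : (fun n : ℕ => (l ^ (n + 1))⁻¹) =O[atTop] fun n : ℕ => (l ^ n)⁻¹ := by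
      refine IsBigO.of_bound l⁻¹ (Eventually.of_forall fun n => le_of_eq ?_)
      rw [pow_succ, mul_inv, norm_mul, mul_comm, Real.norm_of_nonneg (inv_nonneg.2 hl0.le)]
    simpa only [div_eq_mul_inv, mul_pow, inv_pow] using he.mul h1
  have hlim := hsum.hasSum.tendsto_sum_nat
  have heq : ∀ n, ∑ i ∈ Finset.range n, e i / l ^ (i + 1) = W n / l ^ n - W 0 := by
    intro n
    rw [← Finset.sum_congr rfl fun i _ => hdiff i, Finset.sum_range_sub (fun n => W n / l ^ n)]
    simp
  simp only [heq] at hlim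
  have hlim' := hlim.add_const (W 0)
  simp only [sub_add_cancel] at hlim'
  refine ⟨_, ?_, hlim'⟩
  -- `K'` is the fixed point of `t ↦ l * t - max K 0`, so `W - K'` eventually grows by a factor of
  -- at least `l` per step. This makes the limit positive.
  set K' := max K 0 / (l - 1) with hK'
  have hK'0 : 0 ≤ K' := div_nonneg (le_max_right _ _) (by linarith)
  have hK'eq : K' * (l - 1) = max K 0 := div_mul_cancel₀ _ (by linarith)
  obtain ⟨N, hN⟩ := eventually_atTop.1 heK
  obtain ⟨M, hWM, hMN⟩ := ((hWt.eventually_gt_atTop K').and (eventually_ge_atTop N)).exists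
  have hmono : ∀ k, (W M - K') * l ^ k ≤ W (M + k) - K' := by
    intro k
    induction k with
    | zero => simp
    | succ k ih =>
      have h1 := hN (M + k) (by omega)
      have h2 := mul_le_mul_of_nonneg_right ih hl0.le
      have h3 := le_max_left K 0
      rw [← add_assoc, hW, pow_succ]
      nlinarith
  have hpos : 0 < (W M - K') / l ^ M := div_pos (by linarith) (by positivity)
  refine hpos.trans_le (ge_of_tendsto hlim' ?_)
  filter_upwards [eventually_ge_atTop M] with n hn
  have h1 := hmono (n - M)
  rw [Nat.add_sub_of_le hn] at h1
  rw [div_le_div_iff₀ (by positivity) (by positivity)]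
  have h2 : l ^ n = l ^ (n - M) * l ^ M := by rw [← pow_add, Nat.sub_add_cancel hn]
  rw [h2, ← mul_assoc]
  gcongr
  linarith

/-- The left eigenvector `(1, c)` for the eigenvalue `λ` decouples the system: `X + c * Y` satisfies
a scalar recurrence. `X` is then recovered from this combination by a contraction. -/
theorem exists_tendsto_div_lam_pow {d : ℕ} (hd : 1 ≤ d) {κ K : ℝ} (hκ0 : 0 ≤ κ) (hκ : κ < lam d)
    {X Y e : ℕ → ℝ} (hX : ∀ n, X (n + 1) = X n + Y (n + 1))
    (hY : ∀ n, Y (n + 1) = Y n + (d * X n + e n)) (hXt : Tendsto X atTop atTop)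
    (hY0 : ∀ n, 0 ≤ Y n) (he : e =O[atTop] fun n => κ ^ n) (heK : ∀ᶠ n in atTop, -K ≤ e n) :
    ∃ L, 0 < L ∧ Tendsto (fun n => X n / lam d ^ n) atTop (𝓝 L) := by
  have hl := two_lt_lam hd
  have hsq := lam_sq d
  set l := lam d
  have hl1 : 0 < l - 1 := by linarith
  set c := 1 / (l - 1) with hc
  have hcl : c * (l - 1) = 1 := by rw [hc]; field_simp
  have hc0 : 0 < c := by positivity
  have hdc : (d : ℝ) * (1 + c) = l - 1 := by
    rw [hc]; field_simp; linear_combination -hsq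
  obtain ⟨L, hL, hlim⟩ := exists_tendsto_div_pow (l := l) (K := (1 + c) * K)
    (W := fun n => X n + c * Y n)
    (e := fun n => (1 + c) * e n) (by linarith) hκ0 hκ
    (fun n => by
      simp only [hX, hY]
      linear_combination X n * hdc - Y n * hcl)
    (tendsto_atTop_mono (fun n => by have := mul_nonneg hc0.le (hY0 n); linarith) hXt)
    (he.const_mul_left _)
    (heK.mono fun n hn => by
      have := mul_le_mul_of_nonneg_left hn (by linarith : 0 ≤ 1 + c)
      linarith)
  have hθ0 : 0 ≤ 1 / l ^ 2 := by positivity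
  have hθ1 : 1 / l ^ 2 < 1 := by
    rw [div_lt_one (by positivity)]
    nlinarith
  -- Substituting `Y (n + 1) = X (n + 1) - X n` and `1 + c = c * l` gives a recurrence for `X n / l
  -- ^ n` with ratio `c / ((1 + c) * l) = 1 / l ^ 2`.
  have hlim2 := tendsto_of_eq_mul_add (s := fun n => X n / l ^ n) hθ0 hθ1
    ((hlim.comp (tendsto_add_atTop_nat 1)).div_const (1 + c)) (fun n => by
      have hl0 : l ≠ 0 := by linarith
      have hcl' : 1 + c = c * l := by linear_combination -hcl
      have hY' : Y (n + 1) = X (n + 1) - X n := by rw [hX]; ring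
      simp only [Function.comp_apply, hY', hcl', pow_succ]
      field_simp
      linear_combination X (n + 1) * hcl)
  exact ⟨_, div_pos (div_pos hL (by linarith)) (by linarith), hlim2⟩

/-! ### Series whose denominators at least double. -/

theorem abs_div_le_geometric {a s : ℕ → ℝ} (ha : ∀ n, 0 < a n) (h2 : ∀ n, 2 * a n ≤ a (n + 1))
    (hs : ∀ n, |s n| ≤ 1) (n i : ℕ) : ‖s (i + n) / a (i + n)‖ ≤ 1 / a n * (1 / 2) ^ i := by
  have h : ∀ i, a n * 2 ^ i ≤ a (i + n) := by
    intro i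
    induction i with
    | zero => simp
    | succ i ih =>
      have := h2 (i + n)
      rw [pow_succ, show i + 1 + n = i + n + 1 by ring]
      linarith
  have hn := ha n
  rw [Real.norm_eq_abs, abs_div, abs_of_pos (ha _), one_div_pow, one_div_mul_one_div]
  exact div_le_div₀ zero_le_one (hs _) (by positivity) (h i)

theorem summable_div_of_two_mul_le {a s : ℕ → ℝ} (ha : ∀ n, 0 < a n)
    (h2 : ∀ n, 2 * a n ≤ a (n + 1)) (hs : ∀ n, |s n| ≤ 1) : Summable fun n => s n / a n :=
  Summable.of_norm_bounded (summable_geometric_two.mul_left (1 / a 0))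
    fun i => abs_div_le_geometric ha h2 hs 0 i

theorem abs_tsum_div_le {a s : ℕ → ℝ} (ha : ∀ n, 0 < a n)
    (h2 : ∀ n, 2 * a n ≤ a (n + 1)) (hs : ∀ n, |s n| ≤ 1) (n : ℕ) :
    |∑' i, s (i + n) / a (i + n)| ≤ 2 / a n := by
  have := tsum_of_norm_bounded (hasSum_geometric_two.mul_left (1 / a n))
    (abs_div_le_geometric ha h2 hs n)
  rwa [one_div_mul_eq_div] at this

/-! ### The common recursion, its chain of approximations and the exponent. -/

/-- The recursion of the modified Engel and Pierce series, with all indices shifted to start at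
`0`; `s n` is the numerator of the term with denominator `x (n + 1)`. -/
structure IsModifiedSeries (x y u s : ℕ → ℤ) (δ : ℤ) : Prop where
  x_zero_pos : 0 < x 0
  y_zero_pos : 0 < y 0
  u_pos : ∀ n, 0 < u n
  y_succ : ∀ n, y (n + 1) = y n * (1 + u n * x n)
  x_succ : ∀ n, x (n + 1) = x n * y (n + 1)
  sign_delta : δ = 1 ∨ δ = -1
  sign : ∀ n, s n = 1 ∨ s n = -1
  sign_succ : ∀ n, s (n + 1) = δ * s n
  one_lt_x_zero : δ = -1 → 1 < x 0

/-- The numerator, over the denominator `x n`, of the `n`-th partial sum of the series. -/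
def partialNum (p : ℤ) (y s : ℕ → ℤ) : ℕ → ℤ
  | 0 => p
  | n + 1 => partialNum p y s n * y (n + 1) + s n

namespace IsModifiedSeries

variable {x y u s : ℕ → ℤ} {δ p : ℤ}

theorem pos (h : IsModifiedSeries x y u s δ) (n : ℕ) : 0 < x n ∧ 0 < y n := by
  induction n with
  | zero => exact ⟨h.x_zero_pos, h.y_zero_pos⟩
  | succ n ih =>
    have hy : 0 < y (n + 1) := by
      rw [h.y_succ]
      have := mul_pos (h.u_pos n) ih.1
      exact mul_pos ih.2 (by omega)
    exact ⟨h.x_succ n ▸ mul_pos ih.1 hy, hy⟩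

theorem x_add_one_le (h : IsModifiedSeries x y u s δ) (n : ℕ) : x n + 1 ≤ y (n + 1) := by
  obtain ⟨hx, hy⟩ := h.pos n
  have hu := h.u_pos n
  rw [h.y_succ]
  nlinarith [mul_pos hu hx]

theorem two_mul_y_le (h : IsModifiedSeries x y u s δ) (n : ℕ) : 2 * y n ≤ y (n + 1) := by
  obtain ⟨hx, hy⟩ := h.pos n
  rw [h.y_succ]
  nlinarith [mul_pos (h.u_pos n) hx]

theorem two_mul_x_le (h : IsModifiedSeries x y u s δ) (n : ℕ) : 2 * x n ≤ x (n + 1) := by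
  obtain ⟨hx, -⟩ := h.pos n
  have := h.x_add_one_le n
  rw [h.x_succ]
  nlinarith

theorem tendsto_x (h : IsModifiedSeries x y u s δ) :
    Tendsto (fun n => (x n : ℝ)) atTop atTop := by
  have h1 : StrictMono x := strictMono_nat_of_lt_succ fun n => by
    have := h.two_mul_x_le n
    have := (h.pos n).1
    omega
  have h2 : Tendsto x atTop atTop := by
    refine tendsto_atTop_mono (f := fun n : ℕ => (n : ℤ)) (fun n => ?_) tendsto_natCast_atTop_atTop
    induction n with
    | zero => exact (h.pos 0).1.le
    | succ n ih =>
      have := h1 n.lt_succ_self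
      simp only [Nat.succ_eq_add_one] at this
      push_cast
      omega
  exact tendsto_intCast_atTop_atTop.comp h2

theorem abs_sign (h : IsModifiedSeries x y u s δ) (n : ℕ) : |(s n : ℝ)| = 1 := by
  rcases h.sign n with h | h <;> simp [h]

theorem sign_mul_self (h : IsModifiedSeries x y u s δ) (n : ℕ) : s n * s n = 1 := by
  rcases h.sign n with h | h <;> simp [h]

theorem cast_x_pos (h : IsModifiedSeries x y u s δ) (n : ℕ) : (0 : ℝ) < x n := by
  exact_mod_cast (h.pos n).1

theorem cast_y_pos (h : IsModifiedSeries x y u s δ) (n : ℕ) : (0 : ℝ) < y n := by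
  exact_mod_cast (h.pos n).2

theorem cast_two_mul_x_le (h : IsModifiedSeries x y u s δ) (n : ℕ) :
    2 * (x n : ℝ) ≤ x (n + 1) := by
  exact_mod_cast h.two_mul_x_le n

theorem summable (h : IsModifiedSeries x y u s δ) :
    Summable fun i => (s i : ℝ) / x (i + 1) :=
  summable_div_of_two_mul_le (a := fun i => (x (i + 1) : ℝ)) (fun _ => h.cast_x_pos _)
    (fun _ => h.cast_two_mul_x_le _) fun _ => (h.abs_sign _).le

theorem partialNum_div (h : IsModifiedSeries x y u s δ) (p : ℤ) (n : ℕ) :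
    (partialNum p y s n : ℝ) / x n = p / x 0 + ∑ i ∈ Finset.range n, (s i : ℝ) / x (i + 1) := by
  induction n with
  | zero => simp [partialNum]
  | succ n ih =>
    have hx := h.cast_x_pos n
    have hy := h.cast_y_pos (n + 1)
    rw [Finset.sum_range_succ, ← add_assoc, ← ih, partialNum, h.x_succ]
    push_cast
    field_simp

theorem sub_partialNum_div (h : IsModifiedSeries x y u s δ) (p : ℤ) (n : ℕ) :
    (p : ℝ) / x 0 + ∑' i, (s i : ℝ) / x (i + 1) - partialNum p y s n / x n =
      ∑' i, (s (i + n) : ℝ) / x (i + n + 1) := by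
  rw [h.partialNum_div, ← h.summable.sum_add_tsum_nat_add n]
  ring

theorem abs_sub_partialNum_div_le (h : IsModifiedSeries x y u s δ) (p : ℤ) (n : ℕ) :
    |(p : ℝ) / x 0 + ∑' i, (s i : ℝ) / x (i + 1) - partialNum p y s n / x n| ≤ 2 / x (n + 1) := by
  rw [h.sub_partialNum_div]
  exact abs_tsum_div_le (a := fun i => (x (i + 1) : ℝ)) (s := fun i => (s i : ℝ)) (fun _ => h.cast_x_pos _)
    (fun _ => h.cast_two_mul_x_le _) (fun _ => (h.abs_sign _).le) n

/-- Equality would make the next partial sum wrong by exactly `1 / x (n + 1)`, whereas its error is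
at most `2 / x (n + 2)`, which is no more than half of that. -/
theorem ne_partialNum_div (h : IsModifiedSeries x y u s δ) (p : ℤ) (n : ℕ) :
    (p : ℝ) / x 0 + ∑' i, (s i : ℝ) / x (i + 1) ≠ partialNum p y s n / x n := by
  intro heq
  have h1 := h.abs_sub_partialNum_div_le p (n + 1)
  have hx := h.cast_x_pos (n + 1)
  have hy : (4 : ℝ) ≤ y (n + 1 + 1) := by
    have h2 := h.two_mul_y_le n
    have h3 := h.two_mul_y_le (n + 1)
    have h4 := (h.pos n).2
    exact_mod_cast (by omega : 4 ≤ y (n + 1 + 1))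
  have h2 : (partialNum p y s n : ℝ) / x n - partialNum p y s (n + 1) / x (n + 1) =
      -(s n / x (n + 1)) := by
    rw [h.partialNum_div, h.partialNum_div, Finset.sum_range_succ]
    ring
  rw [heq, h2, abs_neg, abs_div, h.abs_sign, abs_of_pos hx, h.x_succ (n + 1), Int.cast_mul,
    div_le_div_iff₀ hx (by positivity)] at h1
  nlinarith

theorem tendsto_partialNum_div (h : IsModifiedSeries x y u s δ) (p : ℤ) :
    Tendsto (fun n => (partialNum p y s n : ℝ) / x n) atTop
      (𝓝 (p / x 0 + ∑' i, (s i : ℝ) / x (i + 1))) := by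
  simp only [h.partialNum_div]
  exact h.summable.hasSum.tendsto_sum_nat.const_add _

/-- Between two consecutive partial sums there is a further convergent, of denominator
`y (n + 1) - δ`. -/
theorem exists_intermediate (h : IsModifiedSeries x y u s δ)
    (hp : ∃ Q, p * (y 0 - δ) = -s 0 + x 0 * Q) (n : ℕ) :
    ∃ Q, partialNum p y s n * (y (n + 1) - δ) = -s n + x n * Q := by
  induction n with
  | zero =>
    obtain ⟨Q, hQ⟩ := hp
    refine ⟨Q + p * y 0 * u 0, ?_⟩
    rw [h.y_succ, partialNum]
    linear_combination hQ
  | succ n ih =>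
    obtain ⟨Q, hQ⟩ := ih
    -- Modulo `x (n + 1)`, `y (n + 2)` equals `y (n + 1)`. Multiplying `hQ` by `y (n + 1)` cancels
    -- the `s n * y (n + 1)` coming from `partialNum`, leaving `-δ * s n = -s (n + 1)`.
    refine ⟨Q + partialNum p y s (n + 1) * y (n + 1) * u (n + 1), ?_⟩
    rw [h.y_succ (n + 1), h.sign_succ, partialNum, h.x_succ]
    linear_combination y (n + 1) * hQ

theorem delta_bounds (h : IsModifiedSeries x y u s δ) : -1 ≤ δ ∧ δ ≤ 1 := by
  rcases h.sign_delta with h | h <;> simp [h]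

theorem sub_delta_pos (h : IsModifiedSeries x y u s δ) (n : ℕ) : 0 < y (n + 1) - δ := by
  have := h.delta_bounds
  have := h.x_add_one_le n
  have := (h.pos n).1
  omega

theorem sub_delta_le (h : IsModifiedSeries x y u s δ) (n : ℕ) :
    y (n + 1) - δ ≤ 2 * y (n + 1) := by
  have := h.delta_bounds
  have := h.x_add_one_le n
  have := (h.pos n).1
  omega

theorem le_two_mul_sub_delta (h : IsModifiedSeries x y u s δ) (n : ℕ) :
    y (n + 1) ≤ 2 * (y (n + 1) - δ) := by
  have := h.delta_bounds
  have := h.x_add_one_le n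
  have := (h.pos n).1
  omega

theorem sub_delta_le_x (h : IsModifiedSeries x y u s δ) (n : ℕ) :
    y (n + 1) - δ ≤ x (n + 1) := by
  obtain ⟨hx, -⟩ := h.pos n
  have hy := (h.pos (n + 1)).2
  rw [h.x_succ]
  rcases h.sign_delta with hδ | hδ
  · rw [hδ]
    nlinarith
  -- For `δ = -1` the claim is `y + 1 ≤ x n * y`, which fails for `x n = 1`; hence the condition `q
  -- > 1` in the Pierce cases.
  · have hx1 : 1 < x n := by
      rcases n with _ | n
      · exact h.one_lt_x_zero hδ
      · have := h.two_mul_x_le n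
        have := (h.pos n).1
        omega
    rw [hδ]
    nlinarith

theorem sub_partialNum_mul (h : IsModifiedSeries x y u s δ) {n : ℕ} {Q : ℤ}
    (hQ : partialNum p y s n * (y (n + 1) - δ) = -s n + x n * Q) :
    Q * x (n + 1) - partialNum p y s (n + 1) * (y (n + 1) - δ) = s n * δ := by
  rw [partialNum, h.x_succ]
  linear_combination -y (n + 1) * hQ

theorem abs_sub_intermediate_le (h : IsModifiedSeries x y u s δ) {n : ℕ} {Q : ℤ}
    (hQ : partialNum p y s n * (y (n + 1) - δ) = -s n + x n * Q) :
    |(p : ℝ) / x 0 + ∑' i, (s i : ℝ) / x (i + 1) - Q / (y (n + 1) - δ : ℤ)| ≤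
      4 / ((y (n + 1) - δ : ℤ) * x (n + 1)) := by
  have hx := h.cast_x_pos (n + 1)
  have hz : (0 : ℝ) < (y (n + 1) - δ : ℤ) := by exact_mod_cast h.sub_delta_pos n
  have h1 := h.abs_sub_partialNum_div_le p (n + 1)
  have h2 := h.sub_partialNum_mul hQ
  have h3 : (partialNum p y s (n + 1) : ℝ) / x (n + 1) - Q / (y (n + 1) - δ : ℤ) =
      -((s n * δ : ℤ) : ℝ) / ((y (n + 1) - δ : ℤ) * x (n + 1)) := by
    rw [← h2]
    push_cast at hz ⊢
    field_simp
    ring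
  have h4 : |((s n * δ : ℤ) : ℝ)| = 1 := by
    have : |(δ : ℝ)| = 1 := by rcases h.sign_delta with h | h <;> simp [h]
    rw [Int.cast_mul, abs_mul, h.abs_sign, this, one_mul]
  have h5 := abs_sub_le ((p : ℝ) / x 0 + ∑' i, (s i : ℝ) / x (i + 1))
    (partialNum p y s (n + 1) / x (n + 1)) (Q / (y (n + 1) - δ : ℤ))
  rw [h3, abs_div, abs_neg, h4, abs_of_pos (mul_pos hz hx)] at h5
  have h6 : (2 : ℝ) / x (n + 1 + 1) ≤ 2 / ((y (n + 1) - δ : ℤ) * x (n + 1)) := by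
    have h7 : ((y (n + 1) - δ : ℤ) : ℝ) ≤ y (n + 1 + 1) := by
      exact_mod_cast (h.sub_delta_le n).trans (h.two_mul_y_le (n + 1))
    rw [h.x_succ (n + 1), Int.cast_mul, mul_comm (x (n + 1) : ℝ)]
    gcongr
  have h8 : 4 / (((y (n + 1) - δ : ℤ) : ℝ) * x (n + 1)) =
      2 / ((y (n + 1) - δ : ℤ) * x (n + 1)) + 1 / ((y (n + 1) - δ : ℤ) * x (n + 1)) +
        1 / ((y (n + 1) - δ : ℤ) * x (n + 1)) := by ring
  have h9 : 0 < 1 / (((y (n + 1) - δ : ℤ) : ℝ) * x (n + 1)) := by positivity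
  linarith

/-- `log y (n + 1)` is the difference of consecutive `log x`, and subtracting `δ` changes `y (n +
1)` by a factor of at most 2 either way. -/
theorem tendsto_log_y_div_pow (h : IsModifiedSeries x y u s δ) {l L : ℝ} (hl : 2 < l)
    (hlim : Tendsto (fun n => Real.log (x n) / l ^ n) atTop (𝓝 L)) :
    Tendsto (fun n => Real.log (x (n + 1)) / l ^ n) atTop (𝓝 (l * L)) ∧
      Tendsto (fun n => Real.log (y (n + 1) - δ : ℤ) / l ^ n) atTop (𝓝 ((l - 1) * L)) := by
  have h1 : Tendsto (fun n => Real.log (x (n + 1)) / l ^ n) atTop (𝓝 (l * L)) := by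
    refine ((hlim.comp (tendsto_add_atTop_nat 1)).const_mul l).congr fun n => ?_
    simp only [Function.comp_apply, pow_succ]
    field_simp
  refine ⟨h1, ?_⟩
  have h2 : Tendsto (fun n => (Real.log (y (n + 1) - δ : ℤ) - Real.log (y (n + 1))) / l ^ n)
      atTop (𝓝 0) := by
    refine squeeze_zero_norm (a := fun n => Real.log 2 / l ^ n) (fun n => ?_)
      (tendsto_const_nhds.div_atTop (tendsto_pow_atTop_atTop_of_one_lt (by linarith)))
    have hz : (0 : ℝ) < (y (n + 1) - δ : ℤ) := by exact_mod_cast h.sub_delta_pos n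
    have hy := h.cast_y_pos (n + 1)
    rw [norm_div, norm_pow, Real.norm_of_nonneg (by linarith : 0 ≤ l), Real.norm_eq_abs]
    gcongr
    rw [abs_le]
    have e1 : ((y (n + 1) - δ : ℤ) : ℝ) ≤ 2 * y (n + 1) := by exact_mod_cast h.sub_delta_le n
    have e2 : (y (n + 1) : ℝ) ≤ 2 * (y (n + 1) - δ : ℤ) := by
      exact_mod_cast h.le_two_mul_sub_delta n
    have e3 := Real.log_le_log hz e1
    have e4 := Real.log_le_log hy e2
    rw [Real.log_mul two_ne_zero hy.ne'] at e3
    rw [Real.log_mul two_ne_zero hz.ne'] at e4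
    constructor <;> linarith
  have h3 := (h1.sub hlim).add h2
  rw [add_zero, ← sub_one_mul] at h3
  refine h3.congr fun n => ?_
  rw [h.x_succ, Int.cast_mul, Real.log_mul (h.cast_x_pos n).ne' (h.cast_y_pos _).ne']
  ring

theorem irrationalityExponent_eq (h : IsModifiedSeries x y u s δ)
    (hp : ∃ Q, p * (y 0 - δ) = -s 0 + x 0 * Q) {l L : ℝ} (hl : 2 < l) (hl2 : l ≤ (l - 1) ^ 2)
    (hL : 0 < L) (hlim : Tendsto (fun n => Real.log (x n) / l ^ n) atTop (𝓝 L)) :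
    irrationalityExponent ((p : ℝ) / x 0 + ∑' i, (s i : ℝ) / x (i + 1)) = l := by
  obtain ⟨hlimx, hlimz⟩ := h.tendsto_log_y_div_pow hl hlim
  have hpow : ∀ n : ℕ, 0 < l ^ n := fun n => by positivity
  apply le_antisymm
  · refine irrationalityExponent_le_of_finite fun μ hμ => ?_
    obtain ⟨τ, hτ1, hτ2⟩ := exists_between (by linarith : l - 1 < μ - 1)
    choose Q hQ using h.exists_intermediate hp
    have hlt1 : (l - 1) * L < τ * L := by gcongr
    -- The growth from `z n` to `x (n + 1)` is the milder one: `l ≤ (l - 1) ^ 2 < τ * (l - 1)`.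
    have hlt2 : l * L < τ * ((l - 1) * L) := by
      rw [← mul_assoc]
      gcongr
      nlinarith
    refine finite_approx_of_chain (x := x) (P := partialNum p y s) (Q := Q)
      (z := fun n => y (n + 1) - δ) (C := 4) (τ := τ) (by norm_num) (fun n => (h.pos n).1)
      (fun n => ?_) (fun n => ?_) h.tendsto_x (fun n => ?_)
      (fun n => h.abs_sub_intermediate_le (hQ n)) (fun n => ?_) (fun n => ?_) (by linarith)
      ?_ ?_ (by linarith)
    · have := h.delta_bounds
      have := h.x_add_one_le n
      omega
    · exact h.sub_delta_le_x n
    · refine (h.abs_sub_partialNum_div_le p n).trans ?_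
      have hx := h.cast_x_pos n
      have hx' := h.cast_x_pos (n + 1)
      have hz : (0 : ℝ) < (y (n + 1) - δ : ℤ) := by exact_mod_cast h.sub_delta_pos n
      have hz' : ((y (n + 1) - δ : ℤ) : ℝ) ≤ 2 * y (n + 1) := by exact_mod_cast h.sub_delta_le n
      rw [div_le_div_iff₀ hx' (by positivity), h.x_succ, Int.cast_mul]
      nlinarith
    · intro heq
      have h1 := h.sign_mul_self n
      have h2 : s n = 0 := by linear_combination hQ n - heq
      simp [h2] at h1
    · intro heq
      have h2 := h.sub_partialNum_mul (hQ n)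
      rw [heq, sub_self] at h2
      rcases h.sign n with h3 | h3 <;> rcases h.sign_delta with h4 | h4 <;> simp [h3, h4] at h2
    · filter_upwards [hlimz.eventually_lt (hlim.const_mul τ) hlt1] with n hn
      rw [← mul_div_assoc, div_lt_div_iff_of_pos_right (hpow n)] at hn
      exact hn.le
    · filter_upwards [hlimx.eventually_lt (hlimz.const_mul τ) hlt2] with n hn
      rw [← mul_div_assoc, div_lt_div_iff_of_pos_right (hpow n)] at hn
      exact hn.le
  · refine le_irrationalityExponent_of_infinite (by linarith) fun μ hμ0 hμ => ?_
    refine infinite_approx_of_tendsto hμ0 (fun n => (h.pos n).1) (h.tendsto_partialNum_div p)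
      (h.ne_partialNum_div p) ?_
    -- The logarithmic form of `2 * x n ^ μ < x (n + 1)`, scaled by `l ^ n`.
    have hlim2 : Tendsto (fun n => Real.log 2 / l ^ n + μ * (Real.log (x n) / l ^ n)) atTop
        (𝓝 (0 + μ * L)) :=
      (tendsto_const_nhds.div_atTop (tendsto_pow_atTop_atTop_of_one_lt (by linarith))).add
        (hlim.const_mul μ)
    have hlt : 0 + μ * L < l * L := by rw [zero_add]; gcongr
    filter_upwards [hlim2.eventually_lt hlimx hlt] with n hn
    refine (h.abs_sub_partialNum_div_le p n).trans_lt ?_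
    have hx := h.cast_x_pos n
    have hx' := h.cast_x_pos (n + 1)
    rw [← mul_div_assoc, ← add_div, div_lt_div_iff_of_pos_right (hpow n)] at hn
    rw [div_lt_div_iff₀ hx' (by positivity), one_mul, ← Real.log_lt_log_iff (by positivity) hx',
      Real.log_mul two_ne_zero (by positivity), Real.log_rpow hx]
    exact hn

end IsModifiedSeries

/-! ### Logarithmic growth of the denominators. -/

/-- If `u n = ∑ j < d, v j n * x n ^ (d - 1 - j)` with dominant leading coefficient and `x → ∞`,
then `1 + u n * x n` is asymptotic to `v 0 n * x n ^ d`. -/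
theorem tendsto_one_add_mul_div {d : ℕ} (hd : 1 ≤ d) {x u : ℕ → ℝ} {v : ℕ → ℕ → ℝ}
    (hx : ∀ n, 0 < x n) (hxt : Tendsto x atTop atTop) (hv : ∀ n, 1 ≤ v 0 n)
    (hu : ∀ n, u n = ∑ j ∈ Finset.range d, v j n * x n ^ (d - 1 - j))
    (hO : ∀ j, 1 ≤ j → j ≤ d - 1 → v j =O[atTop] v 0) :
    Tendsto (fun n => (1 + u n * x n) / (v 0 n * x n ^ d)) atTop (𝓝 1) := by
  have hv0 : ∀ n, v 0 n ≠ 0 := fun n => by have := hv n; linarith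
  have hinv : Tendsto (fun n => (x n)⁻¹) atTop (𝓝 0) := hxt.inv_tendsto_atTop
  have h1 : Tendsto (fun n => (v 0 n * x n ^ d)⁻¹) atTop (𝓝 0) := by
    refine (tendsto_atTop_mono (fun n => ?_)
      ((tendsto_pow_atTop (by omega : d ≠ 0)).comp hxt)).inv_tendsto_atTop
    have := pow_pos (hx n) d
    have := hv n
    simp only [Function.comp_apply]
    nlinarith
  have h2 : Tendsto (fun n => ∑ j ∈ Finset.range d, v j n / v 0 n * (x n)⁻¹ ^ j) atTop
      (𝓝 (∑ j ∈ Finset.range d, if j = 0 then 1 else 0)) := by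
    refine tendsto_finsetSum _ fun j hj => ?_
    by_cases hj0 : j = 0
    · simp [hj0, hv0]
    · rw [if_neg hj0]
      have hjd : j ≤ d - 1 := by have := Finset.mem_range.1 hj; omega
      have hb := div_isBoundedUnder_of_isBigO (hO j (by omega) hjd)
      have hp : Tendsto (fun n => (x n)⁻¹ ^ j) atTop (𝓝 0) := by
        simpa [hj0] using hinv.pow j
      exact isBoundedUnder_le_mul_tendsto_zero hb hp
  rw [Finset.sum_ite_eq' , if_pos (Finset.mem_range.2 (by omega))] at h2
  have h3 := h1.add h2
  rw [zero_add] at h3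
  refine h3.congr fun n => ?_
  rw [add_div, one_div, hu, Finset.sum_mul, Finset.sum_div]
  congr 1
  refine Finset.sum_congr rfl fun j hj => ?_
  have hjd : d = d - 1 - j + j + 1 := by have := Finset.mem_range.1 hj; omega
  have := hx n
  have := hv0 n
  rw [show x n ^ d = x n ^ (d - 1 - j) * x n ^ j * x n by
    rw [← pow_add, ← pow_succ, ← hjd], inv_pow]
  field_simp

theorem IsModifiedSeries.exists_tendsto_log_div_pow {x y u s : ℕ → ℤ} {δ : ℤ}
    (h : IsModifiedSeries x y u s δ) {d : ℕ} (hd : 1 ≤ d) {v : ℕ → ℕ → ℤ} (hv : ∀ n, 0 < v 0 n)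
    (huv : ∀ n, u n = ∑ j ∈ Finset.range d, v j n * x n ^ (d - 1 - j))
    {ν : ℝ} (hν₀ : 0 ≤ ν) (hν : ν < lam d)
    (hlog : (fun n => Real.log (v 0 n)) =O[atTop] fun n => ν ^ n)
    (hO : ∀ j, 1 ≤ j → j ≤ d - 1 →
      (fun n => (v j n : ℝ)) =O[atTop] fun n => (v 0 n : ℝ)) :
    ∃ L, 0 < L ∧ Tendsto (fun n => Real.log (x n) / lam d ^ n) atTop (𝓝 L) := by
  have hv1 : ∀ n, (1 : ℝ) ≤ v 0 n := fun n => by exact_mod_cast hv n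
  have hu1 : ∀ n, (0 : ℝ) < 1 + u n * x n := fun n => by
    have := h.cast_x_pos n
    have : (0 : ℝ) < u n := by exact_mod_cast h.u_pos n
    positivity
  have hratio := tendsto_one_add_mul_div hd h.cast_x_pos h.tendsto_x
    (u := fun n => (u n : ℝ)) (v := fun j n => (v j n : ℝ)) hv1
    (fun n => by rw [huv]; push_cast; rfl) hO
  have hlr := hratio.log one_ne_zero
  rw [Real.log_one] at hlr
  have he : ∀ n, Real.log (1 + u n * x n) - d * Real.log (x n) =
      Real.log (v 0 n) + Real.log ((1 + u n * x n) / (v 0 n * x n ^ d)) := by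
    intro n
    have hx := h.cast_x_pos n
    have hv0 : (0 : ℝ) < v 0 n := by linarith [hv1 n]
    rw [Real.log_div (hu1 n).ne' (by positivity), Real.log_mul hv0.ne' (by positivity),
      Real.log_pow]
    ring
  -- The perturbation is `log (v 0 n)` plus a null sequence: base `max ν 1` dominates both, and `K =
  -- 1` works because `log (v 0 n) ≥ 0`.
  refine exists_tendsto_div_lam_pow hd (κ := max ν 1) (K := 1)
    (Y := fun n => Real.log (y n))
    (e := fun n => Real.log (1 + u n * x n) - d * Real.log (x n))
    (le_max_of_le_left hν₀) (max_lt hν (by linarith [two_lt_lam hd])) (fun n => ?_) (fun n => ?_)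
    (Real.tendsto_log_atTop.comp h.tendsto_x) (fun n => ?_) ?_ ?_
  · rw [h.x_succ, Int.cast_mul, Real.log_mul (h.cast_x_pos n).ne' (h.cast_y_pos _).ne']
  · have := Real.log_mul (h.cast_y_pos n).ne' (hu1 n).ne'
    simp only [h.y_succ]
    push_cast
    rw [this]
    ring
  · exact Real.log_nonneg (by exact_mod_cast (h.pos n).2)
  · simp only [he]
    refine IsBigO.add (hlog.trans ?_) ((hlr.isBigO_one ℝ).trans ?_)
    · refine IsBigO.of_bound 1 (Eventually.of_forall fun n => ?_)
      rw [one_mul, norm_pow, norm_pow, Real.norm_of_nonneg hν₀,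
        Real.norm_of_nonneg (le_max_of_le_left hν₀)]
      gcongr
      exact le_max_left _ _
    · refine IsBigO.of_bound 1 (Eventually.of_forall fun n => ?_)
      rw [one_mul, norm_one, norm_pow, Real.norm_of_nonneg (le_max_of_le_left hν₀)]
      exact one_le_pow₀ (le_max_right _ _)
  · filter_upwards [hlr.eventually_const_le (by norm_num : (-1 : ℝ) < 0)] with n hn
    rw [he]
    linarith [Real.log_nonneg (hv1 n)]

/-! ### The three families as instances of the common recursion. -/

/-- The integer sign of the `j`-th term. -/
def SeriesKind.intSign : SeriesKind → ℕ → ℤ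
  | .engel, _ => 1
  | .piercePlus, j => (-1) ^ j
  | .pierceMinus, j => -(-1) ^ j

/-- The ratio of consecutive signs. -/
def SeriesKind.signRatio : SeriesKind → ℤ
  | .engel => 1
  | .piercePlus => -1
  | .pierceMinus => -1

theorem SeriesKind.cast_intSign (T : SeriesKind) (j : ℕ) : (T.intSign j : ℝ) = T.sign j := by
  cases T <;> simp [intSign, sign]

/-- In the Pierce cases, `q > 1` makes the penultimate denominator positive, and the condition on
`m` excludes the only way to get `0`. -/
theorem SeriesKind.IsInitial.pos {T : SeriesKind} {r : ℚ} {m : ℕ} {y₀ : ℤ}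
    (h : T.IsInitial r m y₀) : 0 < y₀ := by
  have hr : 0 < r.den := r.den_pos
  have hmr : 0 ≤ (m : ℤ) * r.den := by positivity
  have hmr' : 1 ≤ m → 1 ≤ (m : ℤ) * r.den := fun hm => by
    exact_mod_cast Nat.mul_pos hm hr
  cases T with
  | engel =>
    obtain ⟨k, a, ha, rfl⟩ := h
    have := (cfDen_nonneg_and_pos ha.1 _ le_rfl).1
    omega
  | piercePlus =>
    obtain ⟨hr1, k, a, ha, rfl, hm⟩ := h
    have := ha.cfDen_pos hr1
    by_cases h1 : cfDen a (2 * k) = 1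
    · have := hmr' (hm h1)
      omega
    · omega
  | pierceMinus =>
    obtain ⟨hr1, k, a, ha, rfl, hm⟩ := h
    have := ha.cfDen_pos hr1
    by_cases h1 : cfDen a (2 * k + 1) = 1
    · have := hmr' (hm h1)
      omega
    · omega

/-- `y₀ - δ` is the penultimate denominator plus `m * q`, so the determinant identity gives the
congruence; the parity of the expansion's length supplies the sign. -/
theorem SeriesKind.IsInitial.exists_num_mul {T : SeriesKind} {r : ℚ} {m : ℕ} {y₀ : ℤ}
    (h : T.IsInitial r m y₀) :
    ∃ Q, r.num * (y₀ - T.signRatio) = -T.intSign 2 + r.den * Q := by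
  cases T with
  | engel =>
    obtain ⟨k, a, ha, rfl⟩ := h
    have h1 := ha.num_mul_cfDen
    rw [pow_succ, pow_mul] at h1
    refine ⟨cfNum a (2 * k) + r.num * m, ?_⟩
    simp only [signRatio, intSign]
    norm_num at h1
    linear_combination h1
  | piercePlus =>
    obtain ⟨hr1, k, a, ha, rfl, hm⟩ := h
    have h1 := ha.num_mul_cfDen
    rw [pow_succ, pow_mul] at h1
    refine ⟨cfNum a (2 * k) + r.num * m, ?_⟩
    simp only [signRatio, intSign]
    norm_num at h1
    linear_combination h1
  | pierceMinus =>
    obtain ⟨hr1, k, a, ha, rfl, hm⟩ := h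
    have h1 := ha.num_mul_cfDen
    rw [pow_succ, pow_succ, pow_mul] at h1
    refine ⟨cfNum a (2 * k + 1) + r.num * m, ?_⟩
    simp only [signRatio, intSign]
    norm_num at h1
    linear_combination h1

theorem SeriesKind.IsInitial.isModifiedSeries {T : SeriesKind} {r : ℚ} {m : ℕ} {y₀ : ℤ}
    (h : T.IsInitial r m y₀) {u : ℕ → ℤ} (hu : ∀ n, 1 ≤ n → 0 < u n) :
    IsModifiedSeries (fun n => xSeq r.den y₀ u (n + 1)) (fun n => ySeq r.den y₀ u n)
      (fun n => u (n + 1)) (fun n => T.intSign (n + 2)) T.signRatio where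
  x_zero_pos := Int.natCast_pos.2 r.den_pos
  y_zero_pos := h.pos
  u_pos n := hu (n + 1) (by omega)
  y_succ n := ySeq_rec _ _ _ (n + 1) (by omega)
  x_succ n := xSeq_rec _ _ _ (n + 1) (by omega)
  sign_delta := by cases T <;> simp [signRatio]
  sign n := by
    rcases neg_one_pow_eq_or ℤ (n + 2) with hs | hs <;> cases T <;> simp [intSign, hs]
  sign_succ n := by
    cases T <;> simp only [intSign, signRatio, pow_succ] <;> ring
  one_lt_x_zero hT := by
    cases T with
    | engel => simp [signRatio] at hT
    | piercePlus => exact Nat.one_lt_cast.2 h.1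
    | pierceMinus => exact Nat.one_lt_cast.2 h.1

end EngelPierce

theorem mainTheorem5
    (T : EngelPierce.SeriesKind) (r : ℚ) (m : ℕ) (y₀ : ℤ)
    (hy₀ : T.IsInitial r m y₀)
    (u : ℕ → ℤ) (hu : ∀ n, 1 ≤ n → 0 < u n)
    (d : ℕ) (hd : 1 ≤ d)
    (v : ℕ → ℕ → ℤ) (hv : ∀ n, 1 ≤ n → 0 < v 0 n)
    (huv : ∀ n, 1 ≤ n →
      u n = ∑ j ∈ Finset.range d, v j n * EngelPierce.xSeq r.den y₀ u n ^ (d - 1 - j))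
    (ν : ℝ) (hν₀ : 0 ≤ ν) (hν : ν < EngelPierce.lam d)
    (hlog : (fun n : ℕ => Real.log (v 0 n : ℝ)) =O[atTop] (fun n : ℕ => ν ^ n))
    (hO : ∀ j, 1 ≤ j → j ≤ d - 1 →
      (fun n : ℕ => (v j n : ℝ)) =O[atTop] (fun n : ℕ => (v 0 n : ℝ))) :
    Summable (fun i : ℕ => EngelPierce.seriesTerm T r y₀ u (i + 2)) ∧
      EngelPierce.irrationalityExponent
          ((r : ℝ) + ∑' i : ℕ, EngelPierce.seriesTerm T r y₀ u (i + 2)) =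
        ((EngelPierce.lam d : ℝ) : EReal) := by
  have h := hy₀.isModifiedSeries hu
  have hl := EngelPierce.two_lt_lam hd
  obtain ⟨L, hL, hlim⟩ := h.exists_tendsto_log_div_pow hd
    (v := fun j n => v j (n + 1)) (fun n => hv _ (by omega)) (fun n => huv _ (by omega)) hν₀ hν
    ((hlog.comp_tendsto (tendsto_add_atTop_nat 1)).trans
      ((isBigO_const_mul_self ν _ _).congr_left fun n => (pow_succ' ν n).symm))
    (fun j hj hjd => (hO j hj hjd).comp_tendsto (tendsto_add_atTop_nat 1))
  have hsq := EngelPierce.lam_sq d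
  have hd' : (1 : ℝ) ≤ d := by exact_mod_cast hd
  have hterm : ∀ i, (T.intSign (i + 2) : ℝ) / EngelPierce.xSeq r.den y₀ u (i + 1 + 1) =
      EngelPierce.seriesTerm T r y₀ u (i + 2) := fun i => by
    rw [EngelPierce.seriesTerm, T.cast_intSign]
  have hsum := h.summable
  -- The inequality left to `nlinarith` is `λ ≤ (λ - 1) ^ 2 = d * λ`.
  have hexp := h.irrationalityExponent_eq hy₀.exists_num_mul hl (by nlinarith) hL hlim
  simp only [hterm] at hsum hexp
  refine ⟨hsum, ?_⟩
  rw [← hexp]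
  congr 2
  exact_mod_cast (Rat.num_div_den r).symm
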